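/- Let $p$ be a natural number and let $(\varepsilon_t)_{t\in\mathbb Z}$ be i.i.d. real random variables on a probability space $(\Omega,\mathcal F,P)$ with $E\varepsilon_1=0$, $E\varepsilon_1^2<\infty$, whose law has a Lebesgue density $g$. Assume that $g$ is differentiable and $$g(x)>0\ \ (x\in\mathbb R),\qquad \lim_{|x|\to\infty}x\,g(x)=0,\qquad \sup_x(1+x^2)|g'(x)|<\infty,\qquad \int_{\mathbb R}|x\,g'(x)|\,dx<\infty .$$ Let $0<\beta\le E\varepsilon_1^2$ and $\Theta=\{a\in\mathbb R^p: a_1,\dots,a_p\ge 0,\ \|a\|_1\le\beta^{-1}\}$, where $\|a\|_1=\sum_i|a_i|$. Let $b\in\Theta$ and $\delta>0$ satisfy $E\varepsilon_1^2\,(\|b\|_1+\delta)<1$, and put $\Theta^\delta=\{a\in\Theta:\|a-b\|_1\le\delta\}$ (so $E\varepsilon_1^2\,(a_1+\dots+a_p)<1$ for all $a\in\Theta^\delta$). For $a\in\Theta^\delta$ let $(y^a_t)_{t\in\mathbb Z}$ be a strictly stationary process on $(\Omega,\mathcal F,P)$ that solves the ARCH($p$) equation, that is, for every $t\in\mathbb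 Z$, almost surely $$y^a_t=\sigma_t\,\varepsilon_t,\qquad \sigma_t=\bigl(1+a_1(y^a_{t-1})^2+\dots+a_p(y^a_{t-p})^2\bigr)^{1/2},$$ and put $Y^a_t=(y^a_t,\dots,y^a_{t-p+1})$. For $\sigma$-algebras $\mathcal A,\mathcal B\subseteq\mathcal F$ let $\alpha(\mathcal A,\mathcal B)=\sup\{|P(A\cap B)-P(A)P(B)|:A\in\mathcal A,\ B\in\mathcal B\}$ be the strong mixing coefficient. Then there are constants $C<\infty$ and $\gamma>0$, not depending on $a$ or $t$, such that for all $a\in\Theta^\delta$ and all $t\in\mathbb Z$ $$\alpha\bigl(\sigma\{Y^a_{t-1}\},\ \sigma\{y^a_s,\ s\le 0\}\bigr)\le C\,e^{-\gamma t}.$$ -/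

import Mathlib

open MeasureTheory ProbabilityTheory Filter Topology

noncomputable section

namespace ARCH

/-- The `ℓ¹` norm on `ℝᵖ`. -/
def l1Norm {p : ℕ} (a : Fin p → ℝ) : ℝ := ∑ i, |a i|

/-- The parameter set `Θ`: nonnegative coordinates and `ℓ¹` norm at most `β⁻¹`. -/
def Theta (p : ℕ) (β : ℝ) : Set (Fin p → ℝ) :=
  {a | (∀ i, 0 ≤ a i) ∧ l1Norm a ≤ β⁻¹}

/-- `Θ^δ`: the part of `Θ` in the closed `ℓ¹` ball of radius `δ` about `b`. -/
def ThetaDelta (p : ℕ) (β : ℝ) (b : Fin p → ℝ) (δ : ℝ) : Set (Fin p → ℝ) :=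
  {a | l1Norm (fun i => a i - b i) ≤ δ} ∩ Theta p β

/-- The regularity conditions on the innovation density: `g` is positive and differentiable,
`x g(x) → 0` as `|x| → ∞`, `sup (1 + x²)|g'(x)| < ∞` and `∫ |x g'(x)| dx < ∞`. -/
structure RegularDensity (g : ℝ → ℝ) : Prop where
  pos : ∀ x, 0 < g x
  differentiable : Differentiable ℝ g
  tendsto_mul : Tendsto (fun x => x * g x) (cocompact ℝ) (𝓝 0)
  deriv_bdd : BddAbove (Set.range fun x => (1 + x ^ 2) * |deriv g x|)
  integrable_deriv : Integrable (fun x => deriv g x * x)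

variable {Ω : Type*} [MeasurableSpace Ω]

/-- `(ε_t)` is a sequence of i.i.d. random variables whose law has Lebesgue density `g`. -/
structure IIDWithDensity (P : Measure Ω) (ε : ℤ → Ω → ℝ) (g : ℝ → ℝ) : Prop where
  measurable : ∀ t, Measurable (ε t)
  indep : iIndepFun ε P
  law : ∀ t, P.map (ε t) = volume.withDensity (fun x => ENNReal.ofReal (g x))

/-- Strict stationarity: the law of the process on `ℝ^ℤ` is invariant under all time shifts. -/
def StrictlyStationary (P : Measure Ω) (y : ℤ → Ω → ℝ) : Prop :=
  ∀ h : ℤ, P.map (fun ω (t : ℤ) => y (t + h) ω) = P.map (fun ω (t : ℤ) => y t ω)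

/-- The lag vector `Y_t = (y_t, …, y_{t-p+1})`. -/
def lagVector (p : ℕ) (y : ℤ → Ω → ℝ) (t : ℤ) (ω : Ω) : Fin p → ℝ :=
  fun j => y (t - (j : ℕ)) ω

/-- `y` is a strictly stationary solution of the ARCH(`p`) equation
`y_t = σ_t ε_t`, `σ_t² = 1 + a₁ y_{t-1}² + … + a_p y_{t-p}²`, `t ∈ ℤ`
(`a j` with `j : Fin p` stands for the coefficient of `y_{t-1-j}²`). -/
structure IsStationarySolution {p : ℕ} (P : Measure Ω) (ε : ℤ → Ω → ℝ) (a : Fin p → ℝ)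
    (y : ℤ → Ω → ℝ) : Prop where
  measurable : ∀ t, Measurable (y t)
  stationary : StrictlyStationary P y
  equation : ∀ t, ∀ᵐ ω ∂P,
    y t ω = √(1 + ∑ j, a j * lagVector p y (t - 1) ω j ^ 2) * ε t ω

/-- The strong mixing coefficient
`α(𝒜, ℬ) = sup {|P(A ∩ B) - P(A) P(B)| : A ∈ 𝒜, B ∈ ℬ}` (a supremum of numbers in `[0, 1]`
when `P` is a probability measure). -/
def strongMixingCoeff (P : Measure Ω) (𝒜 ℬ : MeasurableSpace Ω) : ℝ :=
  sSup {r | ∃ A B : Set Ω, MeasurableSet[𝒜] A ∧ MeasurableSet[ℬ] B ∧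
    r = |P.real (A ∩ B) - P.real A * P.real B|}

/-- `σ{Y_t}`. -/
def sigmaLag (p : ℕ) (y : ℤ → Ω → ℝ) (t : ℤ) : MeasurableSpace Ω :=
  MeasurableSpace.comap (lagVector p y t) inferInstance

/-- `σ{y_s, s ≤ 0}`. -/
def sigmaPast (y : ℤ → Ω → ℝ) : MeasurableSpace Ω :=
  ⨆ s : {s : ℤ // s ≤ 0}, MeasurableSpace.comap (y s) inferInstance

end ARCH

end

namespace ARCH

section

/-- The weight `∫ |g(x) + x g'(x)| dx` controlling the scale family generated by `g`. -/
noncomputable def scaleConst (g : ℝ → ℝ) : ℝ := ∫ x, |g x + deriv g x * x|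

theorem scaleConst_nonneg (g : ℝ → ℝ) : 0 ≤ scaleConst g :=
  integral_nonneg fun _ => abs_nonneg _

theorem RegularDensity.exists_abs_deriv_le {g : ℝ → ℝ} (hg : RegularDensity g) :
    ∃ K, ∀ x, |deriv g x| ≤ K := by
  obtain ⟨K, hK⟩ := hg.deriv_bdd
  refine ⟨K, fun x => le_trans ?_ (hK ⟨x, rfl⟩)⟩
  have := abs_nonneg (deriv g x)
  nlinarith [mul_nonneg (sq_nonneg x) this]

/-- The increments of `w ↦ w g(w z)` are bounded by the integral of its derivative. -/
theorem RegularDensity.abs_scale_sub_le {g : ℝ → ℝ} (hg : RegularDensity g) {u v : ℝ}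
    (huv : u ≤ v) (z : ℝ) :
    |u * g (u * z) - v * g (v * z)| ≤
      ∫ w in Set.Ioc u v, |g (w * z) + deriv g (w * z) * (w * z)| ∧
    IntegrableOn (fun w => |g (w * z) + deriv g (w * z) * (w * z)|) (Set.Ioc u v) := by
  obtain ⟨K, hK⟩ := hg.exists_abs_deriv_le
  have hd : ∀ w : ℝ, HasDerivAt (fun w => w * g (w * z))
      (g (w * z) + deriv g (w * z) * (w * z)) w := by
    intro w
    have h1 : HasDerivAt (fun w : ℝ => w * z) z w := by
      simpa using (hasDerivAt_id w).mul_const z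
    have h2 := ((hg.differentiable (w * z)).hasDerivAt).comp w h1
    have h3 := (hasDerivAt_id w).mul h2
    refine h3.congr_deriv ?_
    simp
    ring
  have hint : IntervalIntegrable (fun w => g (w * z) + deriv g (w * z) * (w * z)) volume u v := by
    refine IntervalIntegrable.add ?_ ?_
    · exact (hg.differentiable.continuous.comp (continuous_id.mul continuous_const)).intervalIntegrable _ _
    · refine IntervalIntegrable.mul_continuousOn ?_ (by fun_prop)
      rw [intervalIntegrable_iff]
      refine Measure.integrableOn_of_bounded (M := K) (by simp)
        ((measurable_deriv g).comp (measurable_id.mul_const z)).aestronglyMeasurable ?_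
      exact ae_of_all _ fun w => hK _
  have h := intervalIntegral.integral_eq_sub_of_hasDerivAt (fun w _ => hd w) hint
  constructor
  · rw [abs_sub_comm, ← h, intervalIntegral.integral_of_le huv]
    exact abs_integral_le_integral_abs
  · have := hint.abs
    rwa [intervalIntegrable_iff_integrableOn_Ioc_of_le huv] at this

/-- Rescaling a regular density moves it in `L¹` by at most a multiple of the change of the
logarithm of the scale. -/
theorem RegularDensity.integral_abs_scale_sub_le {g : ℝ → ℝ} (hg : RegularDensity g)
    (hgi : Integrable g) {u v : ℝ} (hu : 0 < u) (huv : u ≤ v) :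
    ∫ z, |u * g (u * z) - v * g (v * z)| ≤ scaleConst g * (Real.log v - Real.log u) := by
  have hv : 0 < v := hu.trans_le huv
  set k : ℝ → ℝ := fun x => |g x + deriv g x * x| with hk
  have hki : Integrable k := (hgi.add hg.integrable_deriv).abs
  have hkm : Measurable k := by
    have := hg.differentiable.continuous.measurable
    have := measurable_deriv g
    fun_prop
  have hk0 : ∀ x, 0 ≤ k x := fun x => abs_nonneg _
  have hlog : Real.log u ≤ Real.log v := Real.log_le_log hu huv
  have hinner : ∀ w ∈ Set.Ioc u v, ∫⁻ z, ENNReal.ofReal (k (w * z)) =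
      ENNReal.ofReal (w⁻¹ * scaleConst g) := by
    intro w hw
    have hw0 : 0 < w := hu.trans hw.1
    rw [← ofReal_integral_eq_lintegral_ofReal (hki.comp_mul_left' hw0.ne')
      (ae_of_all _ fun _ => hk0 _), Measure.integral_comp_mul_left k w,
      abs_of_pos (inv_pos.2 hw0), smul_eq_mul]
    rfl
  have hinv : IntervalIntegrable (fun w : ℝ => w⁻¹ * scaleConst g) volume u v := by
    refine (ContinuousOn.intervalIntegrable ?_)
    rw [Set.uIcc_of_le huv]
    exact (continuousOn_id.inv₀ fun w hw => (hu.trans_le hw.1).ne').mul continuousOn_const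
  have key : ∫⁻ z, ENNReal.ofReal |u * g (u * z) - v * g (v * z)| ≤
      ENNReal.ofReal (scaleConst g * (Real.log v - Real.log u)) := by
    calc ∫⁻ z, ENNReal.ofReal |u * g (u * z) - v * g (v * z)|
        ≤ ∫⁻ z, ∫⁻ w in Set.Ioc u v, ENNReal.ofReal (k (w * z)) := by
          refine lintegral_mono fun z => ?_
          obtain ⟨h1, h2⟩ := hg.abs_scale_sub_le huv z
          rw [← ofReal_integral_eq_lintegral_ofReal h2 (ae_of_all _ fun _ => hk0 _)]
          exact ENNReal.ofReal_le_ofReal h1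
      _ = ∫⁻ w in Set.Ioc u v, ∫⁻ z, ENNReal.ofReal (k (w * z)) := by
          rw [lintegral_lintegral_swap]
          exact (hkm.comp (measurable_snd.mul measurable_fst)).ennreal_ofReal.aemeasurable
      _ = ∫⁻ w in Set.Ioc u v, ENNReal.ofReal (w⁻¹ * scaleConst g) :=
          setLIntegral_congr_fun measurableSet_Ioc hinner
      _ = ENNReal.ofReal (∫ w in Set.Ioc u v, w⁻¹ * scaleConst g) := by
          rw [ofReal_integral_eq_lintegral_ofReal]
          · exact (intervalIntegrable_iff_integrableOn_Ioc_of_le huv).1 hinv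
          · filter_upwards [ae_restrict_mem measurableSet_Ioc] with w hw
            exact mul_nonneg (inv_nonneg.2 (hu.trans hw.1).le) (scaleConst_nonneg g)
      _ = ENNReal.ofReal (scaleConst g * (Real.log v - Real.log u)) := by
          rw [← intervalIntegral.integral_of_le huv, intervalIntegral.integral_mul_const,
            integral_inv_of_pos hu hv, Real.log_div hv.ne' hu.ne', mul_comm]
  rw [integral_eq_lintegral_of_nonneg_ae (ae_of_all _ fun _ => abs_nonneg _)]
  · exact ENNReal.toReal_le_of_le_ofReal
      (mul_nonneg (scaleConst_nonneg g) (sub_nonneg.2 hlog)) key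
  · have := hg.differentiable.continuous
    exact Continuous.aestronglyMeasurable (by fun_prop)

/-- The `L¹` distance of two scalings with scales at least one, in terms of squared scales. -/
theorem RegularDensity.integral_abs_scale_sub_le_sq {g : ℝ → ℝ} (hg : RegularDensity g)
    (hgi : Integrable g) {s r : ℝ} (hs : 1 ≤ s) (hr : 1 ≤ r) :
    ∫ z, |s⁻¹ * g (s⁻¹ * z) - r⁻¹ * g (r⁻¹ * z)| ≤ scaleConst g * |s ^ 2 - r ^ 2| := by
  wlog hsr : r ≤ s generalizing s r
  · simp_rw [abs_sub_comm (s⁻¹ * _), abs_sub_comm (s ^ 2)]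
    exact this hr hs (le_of_not_ge hsr)
  have hr0 : 0 < r := by linarith
  have hs0 : 0 < s := by linarith
  refine (hg.integral_abs_scale_sub_le hgi (inv_pos.2 hs0) (inv_anti₀ hr0 hsr)).trans ?_
  refine mul_le_mul_of_nonneg_left ?_ (scaleConst_nonneg g)
  rw [Real.log_inv, Real.log_inv, neg_sub_neg, ← Real.log_div hs0.ne' hr0.ne',
    abs_of_nonneg (by nlinarith)]
  have h1 := Real.log_le_sub_one_of_pos (div_pos hs0 hr0)
  have h2 : s / r - 1 ≤ s - r := by
    rw [div_sub_one hr0.ne', div_le_iff₀ hr0]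
    nlinarith
  nlinarith

end

section

variable {p : ℕ}

/-- The volatility `√(1 + ∑ a_j u_j²)` of the state `u`. -/
noncomputable def vol (a u : Fin p → ℝ) : ℝ := √(1 + ∑ j, a j * u j ^ 2)

/-- Put `x` in front of `u` and drop the last coordinate. -/
def push (u : Fin p → ℝ) (x : ℝ) : Fin p → ℝ :=
  fun j => (Fin.cons x u : Fin (p + 1) → ℝ) j.castSucc

/-- One step of the ARCH recursion on states. -/
noncomputable def step (a u : Fin p → ℝ) (e : ℝ) : Fin p → ℝ := push u (vol a u * e)

/-- The `ℓ¹` distance of the coordinatewise squares. -/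
noncomputable def sqDist (u v : Fin p → ℝ) : ℝ := ∑ j, |u j ^ 2 - v j ^ 2|

theorem push_cases (j : Fin p) :
    ((j : ℕ) = 0 ∧ ∀ u x, push u x j = x) ∨
      ∃ i : Fin p, (i : ℕ) + 1 = j ∧ ∀ u x, push u x j = u i := by
  cases p with
  | zero => exact j.elim0
  | succ q =>
    refine Fin.cases (Or.inl ⟨rfl, fun u x => rfl⟩) (fun i => Or.inr ⟨i.castSucc, ?_, ?_⟩) j
    · simp
    · intro u x
      simp only [push, ← Fin.succ_castSucc, Fin.cons_succ]

theorem measurable_vol (a : Fin p → ℝ) : Measurable (vol a) := by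
  unfold vol; fun_prop

theorem measurable_push : Measurable fun q : (Fin p → ℝ) × ℝ => push q.1 q.2 := by
  refine measurable_pi_lambda _ fun j => ?_
  rcases push_cases j with ⟨-, h⟩ | ⟨i, -, h⟩ <;> simp only [h] <;> fun_prop

theorem measurable_step (a : Fin p → ℝ) :
    Measurable fun q : (Fin p → ℝ) × ℝ => step a q.1 q.2 :=
  measurable_push.comp
    (measurable_fst.prodMk (((measurable_vol a).comp measurable_fst).mul measurable_snd))

theorem vol_sq {a : Fin p → ℝ} (ha : ∀ j, 0 ≤ a j) (u : Fin p → ℝ) :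
    vol a u ^ 2 = 1 + ∑ j, a j * u j ^ 2 :=
  Real.sq_sqrt (add_nonneg zero_le_one
    (Finset.sum_nonneg fun j _ => mul_nonneg (ha j) (sq_nonneg _)))

theorem one_le_vol {a : Fin p → ℝ} (ha : ∀ j, 0 ≤ a j) (u : Fin p → ℝ) : 1 ≤ vol a u :=
  Real.one_le_sqrt.2 (le_add_of_nonneg_right
    (Finset.sum_nonneg fun j _ => mul_nonneg (ha j) (sq_nonneg _)))

theorem abs_vol_sq_sub_le {a : Fin p → ℝ} (ha : ∀ j, 0 ≤ a j) (u v : Fin p → ℝ) :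
    |vol a u ^ 2 - vol a v ^ 2| ≤ ∑ j, a j * |u j ^ 2 - v j ^ 2| := by
  rw [vol_sq ha, vol_sq ha, add_sub_add_left_eq_sub, ← Finset.sum_sub_distrib]
  refine (Finset.abs_sum_le_sum_abs _ _).trans (Finset.sum_le_sum fun j _ => ?_)
  rw [← mul_sub, abs_mul, abs_of_nonneg (ha j)]

theorem sqDist_nonneg (u v : Fin p → ℝ) : 0 ≤ sqDist u v :=
  Finset.sum_nonneg fun _ _ => abs_nonneg _

theorem measurable_sqDist_zero (p : ℕ) : Measurable fun u : Fin p → ℝ => sqDist u 0 := by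
  unfold sqDist; fun_prop

theorem sum_mul_abs_le_sqDist {a : Fin p → ℝ} {S : ℝ} (ha : ∀ j, 0 ≤ a j) (hS : ∑ j, a j ≤ S)
    (u v : Fin p → ℝ) : ∑ j, a j * |u j ^ 2 - v j ^ 2| ≤ S * sqDist u v := by
  calc ∑ j, a j * |u j ^ 2 - v j ^ 2| ≤ ∑ j, a j * sqDist u v :=
        Finset.sum_le_sum fun j _ => mul_le_mul_of_nonneg_left
          (Finset.single_le_sum (f := fun j => |u j ^ 2 - v j ^ 2|)
            (fun i _ => abs_nonneg _) (Finset.mem_univ j)) (ha j)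
    _ = (∑ j, a j) * sqDist u v := (Finset.sum_mul ..).symm
    _ ≤ S * sqDist u v := mul_le_mul_of_nonneg_right hS (sqDist_nonneg _ _)

theorem sqDist_push_le (u v : Fin p → ℝ) (x : ℝ) : sqDist (push u x) (push v x) ≤ sqDist u v := by
  unfold sqDist
  have h : ∑ j : Fin p, |push u x j ^ 2 - push v x j ^ 2| + 0 ≤
      ∑ j : Fin (p + 1), |(Fin.cons x u : Fin (p + 1) → ℝ) j ^ 2 -
        (Fin.cons x v : Fin (p + 1) → ℝ) j ^ 2| := by
    rw [Fin.sum_univ_castSucc]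
    exact add_le_add le_rfl (abs_nonneg _)
  rw [Fin.sum_univ_succ] at h
  simpa using h

/-- The transition operator of the ARCH chain with innovation law `ν`. -/
noncomputable def trans (ν : Measure ℝ) (a : Fin p → ℝ) (ψ : (Fin p → ℝ) → ℝ) :
    (Fin p → ℝ) → ℝ :=
  fun u => ∫ e, ψ (step a u e) ∂ν

theorem measurable_trans (ν : Measure ℝ) [SFinite ν] (a : Fin p → ℝ) {ψ : (Fin p → ℝ) → ℝ}
    (hψ : Measurable ψ) : Measurable (trans ν a ψ) :=
  (StronglyMeasurable.integral_prod_right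
    (f := fun (u : Fin p → ℝ) (e : ℝ) => ψ (step a u e))
    (hψ.comp (measurable_step a)).stronglyMeasurable).measurable

theorem abs_trans_le (ν : Measure ℝ) [IsProbabilityMeasure ν] (a : Fin p → ℝ)
    {ψ : (Fin p → ℝ) → ℝ} (hb : ∀ u, |ψ u| ≤ 1) (u : Fin p → ℝ) : |trans ν a ψ u| ≤ 1 := by
  have := norm_integral_le_of_norm_le_const (μ := ν) (f := fun e => ψ (step a u e)) (C := 1)
    (ae_of_all _ fun e => hb _)
  simpa [trans] using this

/-- `ψ` is Lipschitz in the squared coordinates among states with the same first `k`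
coordinates. -/
def LipschitzBeyond (k : ℕ) (L : ℝ) (ψ : (Fin p → ℝ) → ℝ) : Prop :=
  ∀ u v : Fin p → ℝ, (∀ j : Fin p, (j : ℕ) < k → u j = v j) → |ψ u - ψ v| ≤ L * sqDist u v

/-- The innovation law. -/
noncomputable def innov (g : ℝ → ℝ) : Measure ℝ := volume.withDensity fun x => ENNReal.ofReal (g x)

theorem trans_eq_integral_density {g : ℝ → ℝ} (hg : RegularDensity g) {a : Fin p → ℝ}
    (ha : ∀ j, 0 ≤ a j) (ψ : (Fin p → ℝ) → ℝ) (u : Fin p → ℝ) :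
    trans (innov g) a ψ u =
      ∫ z, ψ (push u z) * ((vol a u)⁻¹ * g ((vol a u)⁻¹ * z)) := by
  have hv : 0 < vol a u := zero_lt_one.trans_le (one_le_vol ha u)
  have h1 : trans (innov g) a ψ u = ∫ e, g e * ψ (step a u e) := by
    unfold trans innov
    rw [integral_withDensity_eq_integral_toReal_smul₀
      (hg.differentiable.continuous.measurable.ennreal_ofReal.aemeasurable)
      (ae_of_all _ fun _ => ENNReal.ofReal_lt_top)]
    simp [ENNReal.toReal_ofReal (hg.pos _).le]
  have h2 := Measure.integral_comp_mul_left
    (fun z => ψ (push u z) * ((vol a u)⁻¹ * g ((vol a u)⁻¹ * z))) (vol a u)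
  rw [abs_of_pos (inv_pos.2 hv), smul_eq_mul, eq_inv_mul_iff_mul_eq₀ hv.ne'] at h2
  rw [← h2, h1, ← integral_const_mul]
  refine integral_congr_ae (ae_of_all _ fun e => ?_)
  simp only [step, inv_mul_cancel_left₀ hv.ne']
  field_simp

theorem integral_scale_eq {g : ℝ → ℝ} {s : ℝ} (hs : 0 < s) :
    ∫ z, s⁻¹ * g (s⁻¹ * z) = ∫ z, g z := by
  rw [integral_const_mul, Measure.integral_comp_mul_left, inv_inv, abs_of_pos hs, smul_eq_mul,
    inv_mul_cancel_left₀ hs.ne']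

/-- One transition makes a function, Lipschitz in all but the `k + 1` newest coordinates,
Lipschitz in all but the `k` newest ones. -/
theorem LipschitzBeyond.trans {g : ℝ → ℝ} (hg : RegularDensity g) (hgi : Integrable g)
    (hg1 : ∫ x, g x = 1) {a : Fin p → ℝ} {S : ℝ} (ha : ∀ j, 0 ≤ a j) (hS : ∑ j, a j ≤ S)
    {ψ : (Fin p → ℝ) → ℝ} (hψ : Measurable ψ) (hb : ∀ u, |ψ u| ≤ 1) {k : ℕ} {L : ℝ}
    (h : LipschitzBeyond (k + 1) L ψ) (hL : 0 ≤ L) :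
    LipschitzBeyond k (L + scaleConst g * S) (ARCH.trans (innov g) a ψ) := by
  intro u v huv
  have hgm := hg.differentiable.continuous
  have hu := one_le_vol ha u
  have hv := one_le_vol ha v
  set s := vol a u with hs
  set r := vol a v with hr
  have hs0 : 0 < s := by linarith
  have hr0 : 0 < r := by linarith
  have hpu : ∀ w : Fin p → ℝ, Measurable fun z => ψ (push w z) := fun w =>
    hψ.comp (measurable_push.comp (measurable_const.prodMk measurable_id))
  have hi : ∀ {c : ℝ}, 0 < c → Integrable fun z => c⁻¹ * g (c⁻¹ * z) := fun hc =>
    (hgi.comp_mul_left' (inv_pos.2 hc).ne').const_mul _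
  have hmul : ∀ (w : Fin p → ℝ) {f : ℝ → ℝ}, Integrable f →
      Integrable fun z => ψ (push w z) * f z := fun w f hf =>
    hf.bdd_mul (c := 1) (hpu w).aestronglyMeasurable (ae_of_all _ fun z => hb _)
  rw [trans_eq_integral_density hg ha, trans_eq_integral_density hg ha, ← hs, ← hr]
  have hsplit : (∫ z, ψ (push u z) * (s⁻¹ * g (s⁻¹ * z))) -
      ∫ z, ψ (push v z) * (r⁻¹ * g (r⁻¹ * z)) =
      (∫ z, (ψ (push u z) - ψ (push v z)) * (s⁻¹ * g (s⁻¹ * z))) +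
        ∫ z, ψ (push v z) * (s⁻¹ * g (s⁻¹ * z) - r⁻¹ * g (r⁻¹ * z)) := by
    rw [← integral_add, ← integral_sub (hmul u (hi hs0)) (hmul v (hi hr0))]
    · exact integral_congr_ae (ae_of_all _ fun z => by ring)
    · simp_rw [sub_mul]
      exact (hmul u (hi hs0)).sub (hmul v (hi hs0))
    · exact hmul v ((hi hs0).sub (hi hr0))
  have h1 : |∫ z, (ψ (push u z) - ψ (push v z)) * (s⁻¹ * g (s⁻¹ * z))| ≤ L * sqDist u v := by
    rw [← Real.norm_eq_abs]
    refine (norm_integral_le_of_norm_le ((hi hs0).const_mul (L * sqDist u v))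
      (ae_of_all _ fun z => ?_)).trans ?_
    · have hpos : 0 ≤ s⁻¹ * g (s⁻¹ * z) := mul_nonneg (inv_pos.2 hs0).le (hg.pos _).le
      rw [norm_mul, Real.norm_of_nonneg hpos, Real.norm_eq_abs]
      refine mul_le_mul_of_nonneg_right ((h _ _ ?_).trans
        (mul_le_mul_of_nonneg_left (sqDist_push_le u v z) hL)) hpos
      intro j hj
      rcases push_cases j with ⟨-, h⟩ | ⟨i, hi, h⟩
      · rw [h, h]
      · rw [h, h]
        exact huv i (by omega)
    · rw [integral_const_mul, integral_scale_eq hs0, hg1, mul_one]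
  have h2 : |∫ z, ψ (push v z) * (s⁻¹ * g (s⁻¹ * z) - r⁻¹ * g (r⁻¹ * z))| ≤
      scaleConst g * S * sqDist u v := by
    rw [← Real.norm_eq_abs]
    refine (norm_integral_le_of_norm_le ((hi hs0).sub (hi hr0)).abs
      (ae_of_all _ fun z => ?_)).trans ?_
    · rw [norm_mul]
      exact mul_le_of_le_one_left (norm_nonneg _) (hb _)
    · refine (hg.integral_abs_scale_sub_le_sq hgi hu hv).trans ?_
      rw [mul_assoc]
      exact mul_le_mul_of_nonneg_left
        ((abs_vol_sq_sub_le ha u v).trans (sum_mul_abs_le_sqDist ha hS u v)) (scaleConst_nonneg g)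
  rw [hsplit, add_mul]
  exact (abs_add_le _ _).trans (add_le_add h1 h2)

theorem measurable_iterate_trans (ν : Measure ℝ) [SFinite ν] (a : Fin p → ℝ)
    {ψ : (Fin p → ℝ) → ℝ} (hψ : Measurable ψ) (n : ℕ) : Measurable ((trans ν a)^[n] ψ) := by
  induction n with
  | zero => exact hψ
  | succ n ih =>
    rw [Function.iterate_succ_apply']
    exact measurable_trans ν a ih

theorem abs_iterate_trans_le (ν : Measure ℝ) [IsProbabilityMeasure ν] (a : Fin p → ℝ)
    {ψ : (Fin p → ℝ) → ℝ} (hb : ∀ u, |ψ u| ≤ 1) (n : ℕ) (u : Fin p → ℝ) :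
    |(trans ν a)^[n] ψ u| ≤ 1 := by
  induction n generalizing u with
  | zero => exact hb u
  | succ n ih =>
    rw [Function.iterate_succ_apply']
    exact abs_trans_le ν a ih u

/-- After `p` transitions a bounded measurable function is Lipschitz in the squared coordinates. -/
theorem abs_iterate_trans_sub_le {g : ℝ → ℝ} (hg : RegularDensity g) (hgi : Integrable g)
    (hg1 : ∫ x, g x = 1) [IsProbabilityMeasure (innov g)] {a : Fin p → ℝ} {S : ℝ}
    (ha : ∀ j, 0 ≤ a j) (hS : ∑ j, a j ≤ S)
    {ψ : (Fin p → ℝ) → ℝ} (hψ : Measurable ψ) (hb : ∀ u, |ψ u| ≤ 1) (u v : Fin p → ℝ) :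
    |(trans (innov g) a)^[p] ψ u - (trans (innov g) a)^[p] ψ v| ≤
      p * (scaleConst g * S) * sqDist u v := by
  have hS0 : 0 ≤ S := (Finset.sum_nonneg fun j _ => ha j).trans hS
  have key : ∀ n ≤ p,
      LipschitzBeyond (p - n) (n * (scaleConst g * S)) ((trans (innov g) a)^[n] ψ) := by
    intro n
    induction n with
    | zero =>
      intro _ u v huv
      have : u = v := funext fun j => huv j (by omega)
      simp [this]
    | succ n ih =>
      intro hn
      have h3 := ih (by omega)
      rw [show p - n = p - (n + 1) + 1 by omega] at h3
      have := h3.trans hg hgi hg1 ha hS (measurable_iterate_trans _ a hψ n)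
        (abs_iterate_trans_le _ a hb n)
        (mul_nonneg n.cast_nonneg (mul_nonneg (scaleConst_nonneg g) hS0))
      rw [Function.iterate_succ_apply']
      push_cast
      rwa [add_mul, one_mul]
  exact key p le_rfl u v fun j hj => by omega

end

section

variable {p : ℕ} {Ω : Type*}

/-- The σ-algebra generated by the innovations with index in `I`. -/
abbrev fil (ε : ℤ → Ω → ℝ) (I : Set ℤ) : MeasurableSpace Ω :=
  ⨆ r ∈ I, MeasurableSpace.comap (ε r) inferInstance

theorem fil_mono (ε : ℤ → Ω → ℝ) {I J : Set ℤ} (h : I ⊆ J) : fil ε I ≤ fil ε J :=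
  biSup_mono h

theorem comap_le_fil (ε : ℤ → Ω → ℝ) {I : Set ℤ} {t : ℤ} (ht : t ∈ I) :
    MeasurableSpace.comap (ε t) inferInstance ≤ fil ε I :=
  le_biSup (fun r => MeasurableSpace.comap (ε r) inferInstance) ht

theorem measurable_fil (ε : ℤ → Ω → ℝ) {I : Set ℤ} {t : ℤ} (ht : t ∈ I) :
    Measurable[fil ε I] (ε t) :=
  (comap_measurable (ε t)).mono (comap_le_fil ε ht) le_rfl

/-- The state at time `s + n` of the recursion `f` driven by `ε` and started in `u` at time `s`. -/
def run (f : (Fin p → ℝ) → ℝ → Fin p → ℝ) (u : Fin p → ℝ) (ε : ℤ → Ω → ℝ) (s : ℤ) :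
    ℕ → Ω → Fin p → ℝ
  | 0, _ => u
  | n + 1, ω => f (run f u ε s n ω) (ε (s + n + 1) ω)

theorem measurable_run {f : (Fin p → ℝ) → ℝ → Fin p → ℝ}
    (hf : Measurable fun q : (Fin p → ℝ) × ℝ => f q.1 q.2) (u : Fin p → ℝ) (ε : ℤ → Ω → ℝ)
    (s : ℤ) (n : ℕ) : Measurable[fil ε (Set.Ioc s (s + n))] (run f u ε s n) := by
  induction n with
  | zero => exact measurable_const
  | succ n ih =>
    have h1 : Measurable[fil ε (Set.Ioc s (s + (n + 1 : ℕ)))] (run f u ε s n) :=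
      ih.mono (fil_mono ε (Set.Ioc_subset_Ioc_right (by push_cast; omega))) le_rfl
    have h2 : Measurable[fil ε (Set.Ioc s (s + (n + 1 : ℕ)))] (ε (s + n + 1)) :=
      measurable_fil ε ⟨by omega, by push_cast; omega⟩
    exact hf.comp (h1.prodMk h2)

/-- One step of the linear recursion dominating differences of squared ARCH states. -/
def linStep (a w : Fin p → ℝ) (e : ℝ) : Fin p → ℝ := push w ((∑ j, a j * w j) * e ^ 2)

theorem measurable_linStep (a : Fin p → ℝ) :
    Measurable fun q : (Fin p → ℝ) × ℝ => linStep a q.1 q.2 := by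
  refine measurable_push.comp (measurable_fst.prodMk ?_)
  fun_prop

theorem run_linStep_nonneg {a : Fin p → ℝ} (ha : ∀ j, 0 ≤ a j) (ε : ℤ → Ω → ℝ) (s : ℤ) (n : ℕ)
    (ω : Ω) (j : Fin p) : 0 ≤ run (linStep a) (fun _ => 1) ε s n ω j := by
  induction n generalizing j with
  | zero => exact zero_le_one
  | succ n ih =>
    simp only [run, linStep]
    rcases push_cases j with ⟨-, h⟩ | ⟨i, -, h⟩
    · rw [h]
      exact mul_nonneg (Finset.sum_nonneg fun i _ => mul_nonneg (ha i) (ih i)) (sq_nonneg _)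
    · rw [h]
      exact ih i

/-- Two ARCH states driven by the same innovation stay within the linear recursion. -/
theorem abs_step_sq_sub_le {a : Fin p → ℝ} (ha : ∀ j, 0 ≤ a j) {u v w : Fin p → ℝ} {M : ℝ}
    (h : ∀ j, |u j ^ 2 - v j ^ 2| ≤ M * w j) (e : ℝ) (j : Fin p) :
    |step a u e j ^ 2 - step a v e j ^ 2| ≤ M * linStep a w e j := by
  simp only [step, linStep]
  rcases push_cases j with ⟨-, hj⟩ | ⟨i, -, hj⟩
  · rw [hj, hj, hj, mul_pow, mul_pow, ← sub_mul, abs_mul, abs_of_nonneg (sq_nonneg e),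
      ← mul_assoc]
    refine mul_le_mul_of_nonneg_right ((abs_vol_sq_sub_le ha u v).trans ?_) (sq_nonneg e)
    rw [Finset.mul_sum]
    refine Finset.sum_le_sum fun i _ => ?_
    rw [mul_left_comm]
    exact mul_le_mul_of_nonneg_left (h i) (ha i)
  · rw [hj, hj, hj]
    exact h i

/-- Comparison of an ARCH path with the path started at zero at time `s`. -/
theorem abs_sq_sub_run_le {a : Fin p → ℝ} (ha : ∀ j, 0 ≤ a j) (ε : ℤ → Ω → ℝ)
    (Y : ℤ → Ω → Fin p → ℝ) {ω : Ω} (hY : ∀ t, Y (t + 1) ω = step a (Y t ω) (ε (t + 1) ω))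
    (s : ℤ) (n : ℕ) (j : Fin p) :
    |Y (s + n) ω j ^ 2 - run (step a) 0 ε s n ω j ^ 2| ≤
      sqDist (Y s ω) 0 * run (linStep a) (fun _ => 1) ε s n ω j := by
  induction n generalizing j with
  | zero =>
    simp only [run, Nat.cast_zero, add_zero, mul_one]
    exact Finset.single_le_sum (f := fun j => |Y s ω j ^ 2 - (0 : Fin p → ℝ) j ^ 2|)
      (fun i _ => abs_nonneg _) (Finset.mem_univ j)
  | succ n ih =>
    have e : s + ((n + 1 : ℕ) : ℤ) = s + n + 1 := by push_cast; ring
    rw [e, hY]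
    exact abs_step_sq_sub_le ha ih _ j

variable [MeasurableSpace Ω] {P : Measure Ω} {ε : ℤ → Ω → ℝ} {g : ℝ → ℝ}

theorem IIDWithDensity.fil_le (h : IIDWithDensity P ε g) (I : Set ℤ) :
    fil ε I ≤ ‹MeasurableSpace Ω› :=
  iSup₂_le fun r _ => (h.measurable r).comap_le

theorem IIDWithDensity.indep_fil (h : IIDWithDensity P ε g) {I J : Set ℤ} (hIJ : Disjoint I J) :
    Indep (fil ε I) (fil ε J) P :=
  indep_iSup_of_disjoint (fun r => (h.measurable r).comap_le) h.indep hIJ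

theorem IIDWithDensity.indepFun_fil (h : IIDWithDensity P ε g) {β γ : Type*} [MeasurableSpace β]
    [MeasurableSpace γ] {I J : Set ℤ} {X : Ω → β} {Y : Ω → γ} (hX : Measurable[fil ε I] X)
    (hY : Measurable[fil ε J] Y) (hIJ : Disjoint I J) : IndepFun X Y P :=
  indep_of_indep_of_le_left (indep_of_indep_of_le_right (h.indep_fil hIJ) hY.comap_le) hX.comap_le

theorem IIDWithDensity.indepFun_of_notMem (h : IIDWithDensity P ε g) {β : Type*}
    [MeasurableSpace β] {I : Set ℤ} {X : Ω → β} (hX : Measurable[fil ε I] X) {t : ℤ}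
    (ht : t ∉ I) : IndepFun X (ε t) P :=
  h.indepFun_fil hX (measurable_fil ε (Set.mem_singleton t)) (Set.disjoint_singleton_right.2 ht)

theorem IIDWithDensity.isProbabilityMeasure_innov [IsProbabilityMeasure P]
    (h : IIDWithDensity P ε g) : IsProbabilityMeasure (innov g) := by
  have := Measure.isProbabilityMeasure_map (μ := P) (h.measurable 0).aemeasurable
  rwa [h.law 0] at this

theorem IIDWithDensity.identDistrib (h : IIDWithDensity P ε g) (s t : ℤ) :
    IdentDistrib (ε s) (ε t) P P :=
  ⟨(h.measurable s).aemeasurable, (h.measurable t).aemeasurable, (h.law s).trans (h.law t).symm⟩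

theorem IIDWithDensity.integrable_density [IsProbabilityMeasure P] (h : IIDWithDensity P ε g)
    (hg : RegularDensity g) : Integrable g ∧ ∫ x, g x = 1 := by
  have hp := h.isProbabilityMeasure_innov
  have h1 : ∫⁻ x, ENNReal.ofReal (g x) = 1 := by
    have := hp.measure_univ
    rwa [innov, withDensity_apply _ MeasurableSet.univ, Measure.restrict_univ] at this
  have hi : Integrable g := by
    refine ⟨hg.differentiable.continuous.aestronglyMeasurable, ?_⟩
    rw [hasFiniteIntegral_iff_ofReal (ae_of_all _ fun x => (hg.pos x).le), h1]
    exact ENNReal.one_lt_top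
  refine ⟨hi, ?_⟩
  rw [integral_eq_lintegral_of_nonneg_ae (ae_of_all _ fun x => (hg.pos x).le) hi.1, h1]
  rfl

/-- Integration of a function of the past times a squared new innovation. -/
theorem IIDWithDensity.integral_mul_sq (h : IIDWithDensity P ε g)
    (hsq : Integrable (fun ω => ε 1 ω ^ 2) P) {I : Set ℤ} {X : Ω → ℝ}
    (hX : Measurable[fil ε I] X) (hXi : Integrable X P) {t : ℤ} (ht : t ∉ I) :
    Integrable (fun ω => X ω * ε t ω ^ 2) P ∧
      ∫ ω, X ω * ε t ω ^ 2 ∂P = (∫ ω, X ω ∂P) * ∫ ω, ε 1 ω ^ 2 ∂P := by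
  have hid : IdentDistrib (fun ω => ε t ω ^ 2) (fun ω => ε 1 ω ^ 2) P P :=
    (h.identDistrib t 1).comp (measurable_id.pow_const 2)
  have hti := hid.integrable_iff.2 hsq
  have hind : IndepFun X (fun ω => ε t ω ^ 2) P :=
    (h.indepFun_of_notMem hX ht).comp measurable_id (measurable_id.pow_const 2)
  refine ⟨hind.integrable_mul hXi hti, ?_⟩
  rw [hind.integral_fun_mul_eq_mul_integral hXi.1 hti.1, hid.integral_eq]

theorem IIDWithDensity.integral_linStep_le [IsProbabilityMeasure P] (h : IIDWithDensity P ε g)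
    (hsq : Integrable (fun ω => ε 1 ω ^ 2) P) {a : Fin p → ℝ} {θ : ℝ} (hθ : 0 < θ) (hθ1 : θ ≤ 1)
    (ha : ∀ j, 0 ≤ a j)
    (haθ : (∑ j, a j) * ∫ ω, ε 1 ω ^ 2 ∂P ≤ θ ^ p) (s : ℤ) (n : ℕ) (j : Fin p) :
    Integrable (fun ω => run (linStep a) (fun _ => 1) ε s n ω j) P ∧
      (∫ ω, run (linStep a) (fun _ => 1) ε s n ω j ∂P) * θ ^ (j : ℕ) ≤ θ ^ n := by
  induction n generalizing j with
  | zero =>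
    simp only [run, integrable_const, true_and]
    simpa using pow_le_one₀ hθ.le hθ1
  | succ n ih =>
    simp only [run, linStep]
    rcases push_cases j with ⟨hj0, hj⟩ | ⟨i, hi, hj⟩
    · simp only [hj]
      have hX : Measurable[fil ε (Set.Ioc s (s + n))]
          fun ω => ∑ j, a j * run (linStep a) (fun _ => 1) ε s n ω j :=
        Measurable.comp (g := fun w : Fin p → ℝ => ∑ j, a j * w j) (by fun_prop)
          (measurable_run (measurable_linStep a) (fun _ => 1) ε s n)
      have hXi : ∀ j ∈ Finset.univ,
          Integrable (fun ω => a j * run (linStep a) (fun _ => 1) ε s n ω j) P :=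
        fun j _ => (ih j).1.const_mul _
      obtain ⟨h1, h2⟩ := h.integral_mul_sq hsq hX (integrable_finsetSum _ hXi) (t := s + n + 1)
        (by simp)
      refine ⟨h1, ?_⟩
      have hm : 0 ≤ ∫ ω, ε 1 ω ^ 2 ∂P := integral_nonneg fun _ => sq_nonneg _
      rw [h2, integral_finsetSum _ hXi, hj0, pow_zero, mul_one]
      simp_rw [integral_const_mul]
      have hb : ∀ i, (∫ ω, run (linStep a) (fun _ => 1) ε s n ω i ∂P) * θ ^ p ≤ θ ^ (n + 1) := by
        intro i
        have e : θ ^ p = θ ^ (i : ℕ) * (θ ^ (p - 1 - i) * θ) := by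
          rw [← pow_succ, ← pow_add]
          congr 1
          omega
        rw [e, ← mul_assoc, pow_succ]
        refine mul_le_mul (ih i).2 ?_ (by positivity) (by positivity)
        exact mul_le_of_le_one_left hθ.le (pow_le_one₀ hθ.le hθ1)
      have hb' : ∀ i, (∫ ω, run (linStep a) (fun _ => 1) ε s n ω i ∂P) ≤ θ ^ (n + 1) / θ ^ p :=
        fun i => (le_div_iff₀ (pow_pos hθ p)).2 (hb i)
      calc (∑ i, a i * ∫ ω, run (linStep a) (fun _ => 1) ε s n ω i ∂P) * ∫ ω, ε 1 ω ^ 2 ∂P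
          ≤ (∑ i, a i * (θ ^ (n + 1) / θ ^ p)) * ∫ ω, ε 1 ω ^ 2 ∂P :=
            mul_le_mul_of_nonneg_right (Finset.sum_le_sum fun i _ =>
              mul_le_mul_of_nonneg_left (hb' i) (ha i)) hm
        _ = ((∑ i, a i) * ∫ ω, ε 1 ω ^ 2 ∂P) * (θ ^ (n + 1) / θ ^ p) := by
            rw [← Finset.sum_mul]; ring
        _ ≤ θ ^ p * (θ ^ (n + 1) / θ ^ p) :=
            mul_le_mul_of_nonneg_right haθ (by positivity)
        _ = θ ^ (n + 1) := by field_simp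
    · simp only [hj]
      refine ⟨(ih i).1, ?_⟩
      rw [← hi, pow_succ, pow_succ, ← mul_assoc]
      exact mul_le_mul_of_nonneg_right (ih i).2 hθ.le

/-- The uniform second moment bound of the path started at zero. -/
theorem IIDWithDensity.integral_run_sq_le [IsProbabilityMeasure P] (h : IIDWithDensity P ε g)
    (hsq : Integrable (fun ω => ε 1 ω ^ 2) P) {a : Fin p → ℝ} {κ : ℝ}
    (ha : ∀ j, 0 ≤ a j) (hκ0 : 0 ≤ κ)
    (hκ : (1 + (∑ j, a j) * κ) * ∫ ω, ε 1 ω ^ 2 ∂P ≤ κ) (s : ℤ) (n : ℕ) (j : Fin p) :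
    Integrable (fun ω => run (step a) 0 ε s n ω j ^ 2) P ∧
      ∫ ω, run (step a) 0 ε s n ω j ^ 2 ∂P ≤ κ := by
  induction n generalizing j with
  | zero => simpa [run] using hκ0
  | succ n ih =>
    simp only [run, step]
    rcases push_cases j with ⟨-, hj⟩ | ⟨i, -, hj⟩
    · simp only [hj, mul_pow, vol_sq ha]
      have hX : Measurable[fil ε (Set.Ioc s (s + n))]
          fun ω => 1 + ∑ j, a j * run (step a) 0 ε s n ω j ^ 2 :=
        Measurable.comp (g := fun w : Fin p → ℝ => 1 + ∑ j, a j * w j ^ 2) (by fun_prop)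
          (measurable_run (measurable_step a) 0 ε s n)
      have hXi : ∀ j ∈ Finset.univ,
          Integrable (fun ω => a j * run (step a) 0 ε s n ω j ^ 2) P :=
        fun j _ => (ih j).1.const_mul _
      obtain ⟨h1, h2⟩ := h.integral_mul_sq hsq hX
        ((integrable_const 1).add (integrable_finsetSum _ hXi)) (t := s + n + 1) (by simp)
      refine ⟨h1, ?_⟩
      rw [h2, integral_add (integrable_const 1) (integrable_finsetSum _ hXi),
        integral_finsetSum _ hXi]
      simp_rw [integral_const_mul]
      refine le_trans (mul_le_mul_of_nonneg_right ?_ (integral_nonneg fun _ => sq_nonneg _)) hκ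
      rw [Finset.sum_mul]
      simpa using Finset.sum_le_sum fun i _ => mul_le_mul_of_nonneg_left (ih i).2 (ha i)
    · simp only [hj]
      exact ih i

/-- Fubini's theorem for a function of two independent random variables. -/
theorem integral_eq_integral_integral_of_indepFun {β γ : Type*} [MeasurableSpace β]
    [MeasurableSpace γ] [IsProbabilityMeasure P] {U : Ω → β} {V : Ω → γ} (hU : Measurable U)
    (hV : Measurable V) (hind : IndepFun U V P) {F : β × γ → ℝ} (hF : Measurable F)
    (hi : Integrable (fun ω => F (U ω, V ω)) P) :
    ∫ ω, F (U ω, V ω) ∂P = ∫ ω, ∫ v, F (U ω, v) ∂(P.map V) ∂P := by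
  have := Measure.isProbabilityMeasure_map (μ := P) hU.aemeasurable
  have := Measure.isProbabilityMeasure_map (μ := P) hV.aemeasurable
  have hmap := hind.map_prod_eq_prod_map_map hU.aemeasurable hV.aemeasurable
  have hi' : Integrable F ((P.map U).prod (P.map V)) := by
    rw [← hmap]
    exact (integrable_map_measure hF.aestronglyMeasurable (hU.prodMk hV).aemeasurable).2 hi
  have hL := integral_map (μ := P) (hU.prodMk hV).aemeasurable (f := F) hF.aestronglyMeasurable
  rw [← hL, hmap, integral_prod _ hi', integral_map hU.aemeasurable]
  exact hF.stronglyMeasurable.integral_prod_right'.aestronglyMeasurable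

/-- Conditioning on the past: a new innovation may be integrated out. -/
theorem IIDWithDensity.setIntegral_step_eq [IsProbabilityMeasure P] (h : IIDWithDensity P ε g)
    {I : Set ℤ} {X : Ω → Fin p → ℝ} (hX : Measurable[fil ε I] X) {B : Set Ω}
    (hB : MeasurableSet[fil ε I] B) {t : ℤ} (ht : t ∉ I) (a : Fin p → ℝ)
    {ψ : (Fin p → ℝ) → ℝ} (hψ : Measurable ψ) (hb : ∀ u, |ψ u| ≤ 1) :
    ∫ ω in B, ψ (step a (X ω) (ε t ω)) ∂P = ∫ ω in B, trans (innov g) a ψ (X ω) ∂P := by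
  have hle := h.fil_le I
  have hB' : MeasurableSet B := hle B hB
  have hU : Measurable[fil ε I] fun ω => (B.indicator (fun _ => (1 : ℝ)) ω, X ω) :=
    (measurable_const.indicator hB).prodMk hX
  have hcut : ∀ f : Ω → ℝ, ∫ ω in B, f ω ∂P =
      ∫ ω, B.indicator (fun _ => (1 : ℝ)) ω * f ω ∂P := by
    intro f
    rw [← integral_indicator hB']
    refine integral_congr_ae (ae_of_all _ fun ω => ?_)
    by_cases hω : ω ∈ B <;> simp [hω]
  have hF : Measurable fun q : (ℝ × (Fin p → ℝ)) × ℝ => q.1.1 * ψ (step a q.1.2 q.2) := by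
    have h1 : Measurable fun q : (ℝ × (Fin p → ℝ)) × ℝ => (q.1.2, q.2) := by fun_prop
    have h2 := hψ.comp ((measurable_step a).comp h1)
    exact Measurable.mul (by fun_prop) h2
  have hU' : Measurable fun ω => (B.indicator (fun _ => (1 : ℝ)) ω, X ω) := hU.mono hle le_rfl
  have hi : Integrable
      (fun ω => B.indicator (fun _ => (1 : ℝ)) ω * ψ (step a (X ω) (ε t ω))) P := by
    refine Integrable.of_bound (C := 1)
      (hF.comp (hU'.prodMk (h.measurable t))).aestronglyMeasurable (ae_of_all _ fun ω => ?_)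
    rw [norm_mul]
    refine mul_le_one₀ ?_ (norm_nonneg _) (hb _)
    by_cases hω : ω ∈ B <;> simp [hω]
  rw [hcut, hcut]
  refine (integral_eq_integral_integral_of_indepFun hU' (h.measurable t)
    (h.indepFun_of_notMem hU ht) hF hi).trans ?_
  rw [h.law t]
  refine integral_congr_ae (ae_of_all _ fun ω => ?_)
  exact integral_const_mul _ _

/-- The last `n` innovations may be integrated out. -/
theorem IIDWithDensity.setIntegral_iterate_trans [IsProbabilityMeasure P]
    (h : IIDWithDensity P ε g) {a : Fin p → ℝ} {Y : ℤ → Ω → Fin p → ℝ} {s : ℤ}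
    (hY : ∀ t, s ≤ t → Measurable[fil ε (Set.Iic t)] (Y t))
    (hrec : ∀ t, s ≤ t → ∀ᵐ ω ∂P, Y (t + 1) ω = step a (Y t ω) (ε (t + 1) ω)) {B : Set Ω}
    (hB : MeasurableSet[fil ε (Set.Iic s)] B)
    (n : ℕ) {ψ : (Fin p → ℝ) → ℝ} (hψ : Measurable ψ) (hb : ∀ u, |ψ u| ≤ 1) (t : ℤ)
    (ht : s ≤ t) :
    ∫ ω in B, ψ (Y (t + n) ω) ∂P = ∫ ω in B, (trans (innov g) a)^[n] ψ (Y t ω) ∂P := by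
  have hp := h.isProbabilityMeasure_innov
  induction n generalizing ψ with
  | zero => simp
  | succ n ih =>
    rw [Function.iterate_succ_apply, ← ih (measurable_trans _ a hψ) (abs_trans_le _ a hb),
      ← h.setIntegral_step_eq (hY (t + n) (by omega))
        (fil_mono ε (Set.Iic_subset_Iic.2 (by omega)) B hB) (t := t + n + 1) (by simp) a hψ hb]
    have e : t + ((n + 1 : ℕ) : ℤ) = t + n + 1 := by push_cast; ring
    rw [e]
    refine integral_congr_ae (ae_restrict_of_ae ?_)
    filter_upwards [hrec (t + n) (by omega)] with ω hω
    rw [hω]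

end

section

variable {p : ℕ} {Ω : Type*} {ε y : ℤ → Ω → ℝ} {g : ℝ → ℝ} {a : Fin p → ℝ}

theorem lagVector_succ {x : ℤ → Ω → ℝ} {t : ℤ} {ω : Ω}
    (h : x (t + 1) ω = vol a (lagVector p x t ω) * ε (t + 1) ω) :
    lagVector p x (t + 1) ω = step a (lagVector p x t ω) (ε (t + 1) ω) := by
  funext j
  simp only [step]
  rcases push_cases j with ⟨hj, h'⟩ | ⟨i, hj, h'⟩
  · rw [h', ← h, lagVector, hj]
    simp
  · rw [h', lagVector, lagVector, ← hj]
    congr 1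
    push_cast
    ring

theorem measurable_lagVector {m : MeasurableSpace Ω} {x : ℤ → Ω → ℝ} {t : ℤ}
    (hx : ∀ s ≤ t, Measurable[m] (x s)) : Measurable[m] (lagVector p x t) :=
  measurable_pi_lambda _ fun j => hx _ (by omega)

theorem measurable_sqrt_mul {m : MeasurableSpace Ω} {z : Fin p → Ω → ℝ} {e : Ω → ℝ}
    (hz : ∀ j, Measurable[m] (z j)) (he : Measurable[m] e) :
    Measurable[m] fun ω => √(1 + ∑ j, a j * z j ω) * e ω := by
  fun_prop

variable [MeasurableSpace Ω] {P : Measure Ω}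

theorem IsStationarySolution.equation_succ (hy : IsStationarySolution P ε a y) (t : ℤ) :
    ∀ᵐ ω ∂P, y (t + 1) ω = vol a (lagVector p y t ω) * ε (t + 1) ω := by
  have := hy.equation (t + 1)
  rwa [add_sub_cancel_right] at this

theorem IsStationarySolution.ae_lagVector_succ (hy : IsStationarySolution P ε a y) :
    ∀ᵐ ω ∂P, ∀ t, lagVector p y (t + 1) ω = step a (lagVector p y t ω) (ε (t + 1) ω) := by
  rw [ae_all_iff]
  intro t
  filter_upwards [hy.equation_succ t] with ω hω
  exact lagVector_succ hω

theorem IsStationarySolution.measure_sqDist_eq (hy : IsStationarySolution P ε a y) (s : ℤ)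
    (K : ℝ) : P {ω | K < sqDist (lagVector p y s ω) 0} =
      P {ω | K < sqDist (lagVector p y 0 ω) 0} := by
  have hS : MeasurableSet {x : ℤ → ℝ | K < ∑ j : Fin p, |x (0 - (j : ℕ)) ^ 2 - 0 ^ 2|} := by
    refine measurableSet_lt measurable_const ?_
    fun_prop
  have h := congrArg (fun μ => μ {x : ℤ → ℝ | K < ∑ j : Fin p, |x (0 - (j : ℕ)) ^ 2 - 0 ^ 2|})
    (hy.stationary s)
  beta_reduce at h
  rw [Measure.map_apply (measurable_pi_lambda _ fun t => hy.measurable _) hS,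
    Measure.map_apply (measurable_pi_lambda _ fun t => hy.measurable _) hS] at h
  convert h using 2
  · ext ω
    simp only [Set.mem_ofPred_eq, Set.mem_preimage, sqDist, lagVector, Pi.zero_apply,
      zero_sub, neg_add_eq_sub]
  · rfl

/-- A random variable is bounded up to a small probability. -/
theorem exists_measure_lt_le [IsFiniteMeasure P] {X : Ω → ℝ} (hX : Measurable X) {c : ENNReal}
    (hc : 0 < c) : ∃ K : ℝ, 0 < K ∧ P {ω | K < X ω} ≤ c := by
  have h := tendsto_measure_iInter_atTop (μ := P) (s := fun n : ℕ => {ω | (n : ℝ) < X ω})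
    (fun n => (measurableSet_lt measurable_const hX).nullMeasurableSet)
    (fun n k hnk ω (hω : (k : ℝ) < X ω) => show (n : ℝ) < X ω from
      lt_of_le_of_lt (Nat.cast_le.2 hnk) hω) ⟨0, measure_ne_top _ _⟩
  have h0 : ⋂ n : ℕ, {ω | (n : ℝ) < X ω} = ∅ := by
    refine Set.eq_empty_of_forall_notMem fun ω hω => ?_
    obtain ⟨n, hn⟩ := exists_nat_ge (X ω)
    exact absurd (Set.mem_iInter.1 hω n) (not_lt.2 hn)
  rw [h0, measure_empty] at h
  obtain ⟨n, hn, hn1⟩ := ((ENNReal.tendsto_nhds_zero.1 h c hc).and (eventually_ge_atTop 1)).exists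
  exact ⟨n, by exact_mod_cast hn1, hn⟩

/-- The paths started at zero in the remote past approximate every stationary solution. -/
theorem IsStationarySolution.tendstoInMeasure [IsProbabilityMeasure P]
    (hy : IsStationarySolution P ε a y) (h : IIDWithDensity P ε g)
    (hsq : Integrable (fun ω => ε 1 ω ^ 2) P) {θ : ℝ} (hθ : 0 < θ) (hθ1 : θ < 1)
    (ha : ∀ j, 0 ≤ a j) (haθ : (∑ j, a j) * ∫ ω, ε 1 ω ^ 2 ∂P ≤ θ ^ p) (t : ℤ) (j : Fin p) :
    TendstoInMeasure P (fun (N : ℕ) ω => run (step a) 0 ε (t - N) N ω j ^ 2) atTop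
      fun ω => lagVector p y t ω j ^ 2 := by
  rw [tendstoInMeasure_iff_norm]
  intro η hη
  rw [ENNReal.tendsto_nhds_zero]
  intro c hc
  have hc2 : 0 < c / 2 := ENNReal.half_pos hc.ne'
  have hlagm : Measurable (lagVector p y 0) := measurable_lagVector fun s _ => hy.measurable s
  have hMm : Measurable fun ω => sqDist (lagVector p y 0 ω) 0 :=
    (measurable_sqDist_zero p).comp hlagm
  obtain ⟨K, hK, hKc⟩ := exists_measure_lt_le (P := P) hMm hc2
  have hlim : Tendsto (fun N : ℕ => ENNReal.ofReal (K / η / θ ^ (j : ℕ) * θ ^ N)) atTop (𝓝 0) := by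
    rw [← ENNReal.ofReal_zero]
    refine ENNReal.tendsto_ofReal ?_
    simpa using (tendsto_pow_atTop_nhds_zero_of_lt_one hθ.le hθ1).const_mul (K / η / θ ^ (j : ℕ))
  filter_upwards [ENNReal.tendsto_nhds_zero.1 hlim _ hc2] with N hN
  set W : Ω → ℝ := fun ω => run (linStep a) (fun _ => 1) ε (t - N) N ω j with hW
  obtain ⟨hWi, hWb⟩ := h.integral_linStep_le hsq hθ hθ1.le ha haθ (t - N) N j
  have hW0 : ∀ ω, 0 ≤ W ω := fun ω => run_linStep_nonneg ha ε (t - N) N ω j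
  have hmarkov : P {ω | η / K ≤ W ω} ≤ c / 2 := by
    refine le_trans ?_ hN
    have h1 := mul_meas_ge_le_integral_of_nonneg (ae_of_all P hW0) hWi (η / K)
    rw [← ofReal_measureReal]
    refine ENNReal.ofReal_le_ofReal ?_
    have hηK : 0 < η / K := div_pos hη hK
    have hθj : 0 < θ ^ (j : ℕ) := pow_pos hθ _
    have h2 : η / K * P.real {ω | η / K ≤ W ω} * θ ^ (j : ℕ) ≤ θ ^ N :=
      (mul_le_mul_of_nonneg_right h1 hθj.le).trans hWb
    have h3 : P.real {ω | η / K ≤ W ω} =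
        K / η / θ ^ (j : ℕ) * (η / K * P.real {ω | η / K ≤ W ω} * θ ^ (j : ℕ)) := by
      field_simp
    rw [h3]
    exact mul_le_mul_of_nonneg_left h2 (by positivity)
  rw [← ENNReal.add_halves c]
  refine le_trans ?_ (add_le_add (((hy.measure_sqDist_eq (t - N) K).le).trans hKc) hmarkov)
  refine le_trans (measure_mono_ae ?_) (measure_union_le _ _)
  filter_upwards [hy.ae_lagVector_succ] with ω hω hmem
  have hd := abs_sq_sub_run_le ha ε (lagVector p y) hω (t - N) N j
  rw [sub_add_cancel, abs_sub_comm] at hd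
  have hd' : η ≤ sqDist (lagVector p y (t - N) ω) 0 * W ω := le_trans hmem hd
  by_cases hM : K < sqDist (lagVector p y (t - N) ω) 0
  · exact Or.inl hM
  · refine Or.inr ?_
    change η / K ≤ W ω
    rw [div_le_iff₀' hK]
    exact hd'.trans (mul_le_mul_of_nonneg_right (not_lt.1 hM) (hW0 ω))

/-- The second moment of a stationary solution. -/
theorem IsStationarySolution.integral_sq_le [IsProbabilityMeasure P]
    (hy : IsStationarySolution P ε a y) (h : IIDWithDensity P ε g)
    (hsq : Integrable (fun ω => ε 1 ω ^ 2) P) {θ : ℝ} (hθ : 0 < θ) (hθ1 : θ < 1)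
    (ha : ∀ j, 0 ≤ a j) (haθ : (∑ j, a j) * ∫ ω, ε 1 ω ^ 2 ∂P ≤ θ ^ p) {κ : ℝ} (hκ0 : 0 ≤ κ)
    (hκ : (1 + (∑ j, a j) * κ) * ∫ ω, ε 1 ω ^ 2 ∂P ≤ κ) (t : ℤ) (j : Fin p) :
    Integrable (fun ω => lagVector p y t ω j ^ 2) P ∧ ∫ ω, lagVector p y t ω j ^ 2 ∂P ≤ κ := by
  have hm : AEStronglyMeasurable (fun ω => lagVector p y t ω j ^ 2) P :=
    ((hy.measurable _).pow_const 2).aestronglyMeasurable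
  have hb := eLpNorm_le_of_tendstoInMeasure (p := 1) (C := ENNReal.ofReal κ)
    (Eventually.of_forall fun N => ?_)
    (hy.tendstoInMeasure h hsq hθ hθ1 ha haθ t j) fun N =>
      (h.integral_run_sq_le hsq ha hκ0 hκ (t - N) N j).1.1
  · have hi : Integrable (fun ω => lagVector p y t ω j ^ 2) P :=
      memLp_one_iff_integrable.1 ⟨hm, hb.trans_lt ENNReal.ofReal_lt_top⟩
    refine ⟨hi, ?_⟩
    rw [eLpNorm_one_eq_lintegral_enorm, ← ofReal_integral_norm_eq_lintegral_enorm hi,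
      ENNReal.ofReal_le_ofReal_iff hκ0] at hb
    simpa using hb
  · obtain ⟨h1, h2⟩ := h.integral_run_sq_le hsq ha hκ0 hκ (t - N) N j
    rw [eLpNorm_one_eq_lintegral_enorm, ← ofReal_integral_norm_eq_lintegral_enorm h1]
    refine ENNReal.ofReal_le_ofReal ?_
    simpa using h2

/-- A limit in measure of nonnegative functions, measurable with respect to a sub-σ-algebra, has a
version measurable with respect to it. -/
theorem exists_measurable_ae_eq_of_tendstoInMeasure {m : MeasurableSpace Ω} {f : ℕ → Ω → ℝ}
    {x : Ω → ℝ} (hf : ∀ n, Measurable[m] (f n)) (hx : ∀ ω, 0 ≤ x ω)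
    (h : TendstoInMeasure P f atTop x) : ∃ z : Ω → ℝ, Measurable[m] z ∧ x =ᵐ[P] z := by
  obtain ⟨ns, -, hns⟩ := h.exists_seq_tendsto_ae
  refine ⟨fun ω => (limsup (fun i => ENNReal.ofReal (f (ns i) ω)) atTop).toReal,
    (Measurable.limsup fun i => (hf (ns i)).ennreal_ofReal).ennreal_toReal, ?_⟩
  filter_upwards [hns] with ω hω
  rw [(ENNReal.tendsto_ofReal hω).limsup_eq, ENNReal.toReal_ofReal (hx ω)]

/-- Every stationary solution is, up to null sets, a function of the past innovations. -/
theorem IsStationarySolution.exists_causal_version [IsProbabilityMeasure P]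
    (hy : IsStationarySolution P ε a y) (h : IIDWithDensity P ε g)
    (hsq : Integrable (fun ω => ε 1 ω ^ 2) P) {θ : ℝ} (hθ : 0 < θ) (hθ1 : θ < 1)
    (ha : ∀ j, 0 ≤ a j) (haθ : (∑ j, a j) * ∫ ω, ε 1 ω ^ 2 ∂P ≤ θ ^ p) :
    ∃ x : ℤ → Ω → ℝ, (∀ t, Measurable[fil ε (Set.Iic t)] (x t)) ∧ ∀ t, y t =ᵐ[P] x t := by
  have hlag : ∀ (t : ℤ) (j : Fin p), ∃ z : Ω → ℝ, Measurable[fil ε (Set.Iic t)] z ∧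
      (fun ω => lagVector p y t ω j ^ 2) =ᵐ[P] z := by
    intro t j
    refine exists_measurable_ae_eq_of_tendstoInMeasure (fun N => ?_) (fun ω => sq_nonneg _)
      (hy.tendstoInMeasure h hsq hθ hθ1 ha haθ t j)
    have h1 : Measurable[fil ε (Set.Iic t)] (run (step a) 0 ε (t - N) N) :=
      (measurable_run (measurable_step a) 0 ε (t - N) N).mono
        (fil_mono ε fun r hr => by simpa using hr.2) le_rfl
    exact Measurable.comp (g := fun w : Fin p → ℝ => w j ^ 2) (by fun_prop) h1
  choose z hz hyz using hlag
  refine ⟨fun t ω => √(1 + ∑ j, a j * z (t - 1) j ω) * ε t ω, fun t => ?_, fun t => ?_⟩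
  · have hz' : ∀ j, Measurable[fil ε (Set.Iic t)] (z (t - 1) j) := fun j =>
      (hz (t - 1) j).mono (fil_mono ε (Set.Iic_subset_Iic.2 (by omega))) le_rfl
    exact measurable_sqrt_mul hz' (measurable_fil ε Set.self_mem_Iic)
  · have hall : ∀ᵐ ω ∂P, ∀ j, lagVector p y (t - 1) ω j ^ 2 = z (t - 1) j ω :=
      ae_all_iff.2 fun j => hyz (t - 1) j
    filter_upwards [hall, hy.equation t] with ω h1 h2
    simp only [h2, h1]

end

section

variable {p : ℕ} {Ω : Type*} {ε y : ℤ → Ω → ℝ} {g : ℝ → ℝ} {a : Fin p → ℝ}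
  [MeasurableSpace Ω] {P : Measure Ω}

theorem setIntegral_indicator_comp [IsFiniteMeasure P] {A : Set (Fin p → ℝ)}
    (hA : MeasurableSet A) (B : Set Ω) {X : Ω → Fin p → ℝ}
    (hX : Measurable X) :
    ∫ ω in B, A.indicator (1 : (Fin p → ℝ) → ℝ) (X ω) ∂P = P.real (X ⁻¹' A ∩ B) := by
  have : (fun ω => A.indicator (1 : (Fin p → ℝ) → ℝ) (X ω)) = (X ⁻¹' A).indicator 1 := by
    funext ω
    by_cases hω : X ω ∈ A <;> simp [hω]
  rw [this, integral_indicator_one (hX hA), measureReal_restrict_apply (hX hA)]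

/-- The covariance estimate for a process adapted to the innovations. -/
theorem abs_measureReal_sub_le [IsProbabilityMeasure P]
    (h : IIDWithDensity P ε g) (hg : RegularDensity g)
    (hsq : Integrable (fun ω => ε 1 ω ^ 2) P) {θ : ℝ} (hθ : 0 < θ) (hθ1 : θ < 1)
    (ha : ∀ j, 0 ≤ a j) (haθ : (∑ j, a j) * ∫ ω, ε 1 ω ^ 2 ∂P ≤ θ ^ p) {κ S : ℝ}
    (hS : ∑ j, a j ≤ S)
    {Y : ℤ → Ω → Fin p → ℝ} (hY : ∀ t, Measurable[fil ε (Set.Iic t)] (Y t))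
    (hrec : ∀ᵐ ω ∂P, ∀ t, Y (t + 1) ω = step a (Y t ω) (ε (t + 1) ω))
    (hint : ∀ j, Integrable (fun ω => Y 0 ω j ^ 2) P ∧ ∫ ω, Y 0 ω j ^ 2 ∂P ≤ κ)
    {A : Set (Fin p → ℝ)} (hA : MeasurableSet A) {B : Set Ω}
    (hB : MeasurableSet[fil ε (Set.Iic 0)] B) (n : ℕ) :
    |P.real (Y (n + p) ⁻¹' A ∩ B) - P.real (run (step a) 0 ε 0 (n + p) ⁻¹' A) * P.real B| ≤
      p * (scaleConst g * S) * (p * κ) * (p * θ⁻¹ ^ p) * θ ^ n := by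
  have hp := h.isProbabilityMeasure_innov
  obtain ⟨hgi, hg1⟩ := h.integrable_density hg
  have hY' : ∀ t, Measurable (Y t) := fun t => (hY t).mono (h.fil_le _) le_rfl
  have hB' : MeasurableSet B := h.fil_le _ B hB
  set Z : ℕ → Ω → Fin p → ℝ := run (step a) 0 ε 0 with hZ
  have hZm : ∀ k : ℕ, Measurable[fil ε (Set.Ioc 0 (0 + k))] (Z k) := fun k =>
    measurable_run (measurable_step a) 0 ε 0 k
  have hZ' : ∀ k, Measurable (Z k) := fun k => (hZm k).mono (h.fil_le _) le_rfl
  set ψ : (Fin p → ℝ) → ℝ := A.indicator 1 with hψ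
  have hψm : Measurable ψ := measurable_one.indicator hA
  have hψb : ∀ u, |ψ u| ≤ 1 := fun u => by by_cases hu : u ∈ A <;> simp [hψ, hu]
  set Ψ := (trans (innov g) a)^[p] ψ with hΨ
  have hYΨ : P.real (Y (n + p) ⁻¹' A ∩ B) = ∫ ω in B, Ψ (Y n ω) ∂P := by
    rw [← setIntegral_indicator_comp hA B (hY' _)]
    exact h.setIntegral_iterate_trans (s := 0) (fun t _ => hY t)
      (fun t _ => hrec.mono fun ω hω => hω t) hB p hψm hψb n (by positivity)
  have hZΨ : P.real (Z (n + p) ⁻¹' A) * P.real B = ∫ ω in B, Ψ (Z n ω) ∂P := by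
    have hind : P.real (Z (n + p) ⁻¹' A) * P.real B = P.real (Z (n + p) ⁻¹' A ∩ B) := by
      have hdis : Disjoint (Set.Ioc (0 : ℤ) (0 + (n + p : ℕ))) (Set.Iic 0) :=
        Set.disjoint_left.2 fun r hr hr' => absurd hr.1 (not_lt.2 hr')
      have := (Indep_iff _ _ _).1 (h.indep_fil hdis) (Z (n + p) ⁻¹' A) B (hZm (n + p) hA) hB
      rw [measureReal_def, measureReal_def, measureReal_def, this, ENNReal.toReal_mul]
    rw [hind, ← setIntegral_indicator_comp hA B (hZ' _)]
    have := h.setIntegral_iterate_trans (s := 0) (a := a) (Y := fun t => Z t.toNat) (fun t ht =>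
      (hZm t.toNat).mono (fil_mono ε fun r hr => by have := hr.2; simp at this ⊢; omega) le_rfl)
      (fun t ht => ae_of_all _ fun ω => ?_) hB p hψm hψb n (by positivity)
    · simpa only [← Nat.cast_add, Int.toNat_natCast] using this
    · obtain ⟨k, rfl⟩ := Int.eq_ofNat_of_zero_le ht
      have e : ((k : ℤ) + 1).toNat = k + 1 := by omega
      simp [e, hZ, run]
  have hΨi : ∀ {X : Ω → Fin p → ℝ}, Measurable X → Integrable (fun ω => Ψ (X ω)) P := fun hX =>
    Integrable.of_bound (C := 1)
      ((measurable_iterate_trans _ a hψm p).comp hX).aestronglyMeasurable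
      (ae_of_all _ fun ω => abs_iterate_trans_le _ a hψb p _)
  have hc : 0 ≤ p * (scaleConst g * S) :=
    mul_nonneg p.cast_nonneg (mul_nonneg (scaleConst_nonneg g)
      ((Finset.sum_nonneg fun j _ => ha j).trans hS))
  set W : Fin p → Ω → ℝ := fun j ω => run (linStep a) (fun _ => 1) ε 0 n ω j with hW
  set M : Ω → ℝ := fun ω => sqDist (Y 0 ω) 0 with hM
  have hMe : M = fun ω => ∑ j, Y 0 ω j ^ 2 := by
    funext ω
    simp [hM, sqDist]
  have hMm : Measurable[fil ε (Set.Iic 0)] M := (measurable_sqDist_zero p).comp (hY 0)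
  have hMi : Integrable M P := by
    rw [hMe]
    exact integrable_finsetSum _ fun j _ => (hint j).1
  have hMb : ∫ ω, M ω ∂P ≤ p * κ := by
    rw [hMe, integral_finsetSum _ fun j _ => (hint j).1]
    simpa using Finset.sum_le_sum fun (j : Fin p) (_ : j ∈ Finset.univ) => (hint j).2
  have hM0 : 0 ≤ ∫ ω, M ω ∂P := integral_nonneg fun ω => sqDist_nonneg _ _
  have hMW : ∀ j, Integrable (fun ω => M ω * W j ω) P ∧
      ∫ ω, M ω * W j ω ∂P ≤ p * κ * (θ⁻¹ ^ p * θ ^ n) := by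
    intro j
    obtain ⟨hWi, hWb⟩ := h.integral_linStep_le hsq hθ hθ1.le ha haθ 0 n j
    have hWm : Measurable[fil ε (Set.Ioc 0 (0 + n))] (W j) :=
      (measurable_pi_apply j).comp (measurable_run (measurable_linStep a) (fun _ => 1) ε 0 n)
    have hind : IndepFun M (W j) P := h.indepFun_fil hMm hWm
      (Set.disjoint_left.2 fun r hr hr' => absurd hr'.1 (not_lt.2 hr))
    refine ⟨hind.integrable_mul hMi hWi, ?_⟩
    rw [hind.integral_fun_mul_eq_mul_integral hMi.1 hWi.1]
    have hW0 : 0 ≤ ∫ ω, W j ω ∂P := integral_nonneg fun ω => run_linStep_nonneg ha ε 0 n ω j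
    refine mul_le_mul hMb ?_ hW0 (hM0.trans hMb)
    rw [inv_pow, ← div_eq_inv_mul, le_div_iff₀ (pow_pos hθ p)]
    refine le_trans (mul_le_mul_of_nonneg_left ?_ hW0) hWb
    exact pow_le_pow_of_le_one hθ.le hθ1.le j.2.le
  have hbound : ∀ᵐ ω ∂P, ‖Ψ (Y n ω) - Ψ (Z n ω)‖ ≤
      p * (scaleConst g * S) * ∑ j, M ω * W j ω := by
    filter_upwards [hrec] with ω hω
    refine (abs_iterate_trans_sub_le hg hgi hg1 ha hS hψm hψb _ _).trans
      (mul_le_mul_of_nonneg_left (Finset.sum_le_sum fun j _ => ?_) hc)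
    have := abs_sq_sub_run_le ha ε Y hω 0 n j
    rwa [zero_add] at this
  have hsumi : Integrable (fun ω => p * (scaleConst g * S) * ∑ j, M ω * W j ω) P :=
    (integrable_finsetSum _ fun j _ => (hMW j).1).const_mul _
  rw [hYΨ, hZΨ, ← integral_sub (hΨi (hY' n)).integrableOn (hΨi (hZ' n)).integrableOn,
    ← Real.norm_eq_abs]
  refine (norm_integral_le_of_norm_le hsumi.integrableOn (ae_restrict_of_ae hbound)).trans ?_
  refine (setIntegral_le_integral hsumi
    (hbound.mono fun ω hω => (norm_nonneg _).trans hω)).trans ?_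
  rw [integral_const_mul, integral_finsetSum _ fun j _ => (hMW j).1]
  have hsum := Finset.sum_le_sum fun (j : Fin p) (_ : j ∈ Finset.univ) => (hMW j).2
  rw [Finset.sum_const, Finset.card_univ, Fintype.card_fin, nsmul_eq_mul] at hsum
  refine (mul_le_mul_of_nonneg_left hsum hc).trans (le_of_eq ?_)
  ring

/-- Events of the past of a process agree up to null sets with events of the innovations. -/
theorem exists_measurableSet_ae_eq {x : ℤ → Ω → ℝ}
    (hx : ∀ t, Measurable[fil ε (Set.Iic t)] (x t)) (hyx : ∀ t, y t =ᵐ[P] x t) {B : Set Ω}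
    (hB : MeasurableSet[sigmaPast y] B) :
    ∃ B', MeasurableSet[fil ε (Set.Iic 0)] B' ∧ B =ᵐ[P] B' := by
  have hle : sigmaPast y ≤ eventuallyMeasurableSpace (fil ε (Set.Iic 0)) (ae P) := by
    refine iSup_le fun s => Measurable.comap_le ?_
    have h1 : Measurable[fil ε (Set.Iic 0)] (x s) :=
      (hx s).mono (fil_mono ε (Set.Iic_subset_Iic.2 s.2)) le_rfl
    exact h1.eventuallyMeasurable_of_eventuallyEq (hyx s)
  exact hle B hB

/-- The covariance estimate for stationary solutions. -/
theorem IsStationarySolution.abs_measureReal_sub_le [IsProbabilityMeasure P]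
    (hy : IsStationarySolution P ε a y) (h : IIDWithDensity P ε g) (hg : RegularDensity g)
    (hsq : Integrable (fun ω => ε 1 ω ^ 2) P) {θ : ℝ} (hθ : 0 < θ) (hθ1 : θ < 1)
    (ha : ∀ j, 0 ≤ a j) (haθ : (∑ j, a j) * ∫ ω, ε 1 ω ^ 2 ∂P ≤ θ ^ p) {κ S : ℝ}
    (hS : ∑ j, a j ≤ S) (hκ0 : 0 ≤ κ) (hκ : (1 + (∑ j, a j) * κ) * ∫ ω, ε 1 ω ^ 2 ∂P ≤ κ)
    {A B : Set Ω} (n : ℕ) (hA : MeasurableSet[sigmaLag p y (n + p)] A)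
    (hB : MeasurableSet[sigmaPast y] B) :
    |P.real (A ∩ B) - P.real A * P.real B| ≤
      2 * (p * (scaleConst g * S) * (p * κ) * (p * θ⁻¹ ^ p) * θ ^ n) := by
  obtain ⟨x, hx, hyx⟩ := hy.exists_causal_version h hsq hθ hθ1 ha haθ
  obtain ⟨D, hD, rfl⟩ := hA
  obtain ⟨B', hB', hBB'⟩ := exists_measurableSet_ae_eq hx hyx hB
  have hall : ∀ᵐ ω ∂P, ∀ t, lagVector p y t ω = lagVector p x t ω := by
    filter_upwards [ae_all_iff.2 hyx] with ω hω t
    funext j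
    exact hω _
  have hY : ∀ t, Measurable[fil ε (Set.Iic t)] (lagVector p x t) := fun t =>
    measurable_lagVector fun s hs => (hx s).mono (fil_mono ε (Set.Iic_subset_Iic.2 hs)) le_rfl
  have hrec : ∀ᵐ ω ∂P, ∀ t, lagVector p x (t + 1) ω =
      step a (lagVector p x t ω) (ε (t + 1) ω) := by
    filter_upwards [hall, hy.ae_lagVector_succ] with ω h1 h2 t
    rw [← h1, ← h1, h2]
  have hint : ∀ j, Integrable (fun ω => lagVector p x 0 ω j ^ 2) P ∧
      ∫ ω, lagVector p x 0 ω j ^ 2 ∂P ≤ κ := by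
    intro j
    have e : (fun ω => lagVector p y 0 ω j ^ 2) =ᵐ[P] fun ω => lagVector p x 0 ω j ^ 2 := by
      filter_upwards [hall] with ω hω
      rw [hω]
    have := hy.integral_sq_le h hsq hθ hθ1 ha haθ hκ0 hκ 0 j
    rwa [integrable_congr e, integral_congr_ae e] at this
  have hA' : lagVector p y (n + p) ⁻¹' D =ᵐ[P] lagVector p x (n + p) ⁻¹' D := by
    filter_upwards [hall] with ω hω
    change (lagVector p y (n + p) ω ∈ D) = (lagVector p x (n + p) ω ∈ D)
    rw [hω]
  rw [measureReal_congr (hA'.inter hBB'), measureReal_congr hA', measureReal_congr hBB']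
  have h1 := ARCH.abs_measureReal_sub_le h hg hsq hθ hθ1 ha haθ hS hY hrec hint hD hB' n
  have h2 := ARCH.abs_measureReal_sub_le h hg hsq hθ hθ1 ha haθ hS hY hrec hint hD
    MeasurableSet.univ n
  rw [Set.inter_univ, probReal_univ, mul_one] at h2
  set E := p * (scaleConst g * S) * (p * κ) * (p * θ⁻¹ ^ p) * θ ^ n
  set q := P.real (run (step a) 0 ε 0 (n + p) ⁻¹' D)
  set r := P.real (lagVector p x (n + p) ⁻¹' D)
  have hb0 : 0 ≤ P.real B' := measureReal_nonneg
  have hb1 : P.real B' ≤ 1 := measureReal_le_one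
  have e : P.real (lagVector p x (n + p) ⁻¹' D ∩ B') - r * P.real B' =
      (P.real (lagVector p x (n + p) ⁻¹' D ∩ B') - q * P.real B') + (q - r) * P.real B' := by
    ring
  rw [e, two_mul]
  refine (abs_add_le _ _).trans (add_le_add h1 ?_)
  rw [abs_mul, abs_of_nonneg hb0, abs_sub_comm]
  exact (mul_le_of_le_one_right (abs_nonneg _) hb1).trans h2

theorem abs_measureReal_inter_sub_le_one [IsProbabilityMeasure P] (A B : Set Ω) :
    |P.real (A ∩ B) - P.real A * P.real B| ≤ 1 := by
  have h1 : P.real (A ∩ B) ≤ 1 := measureReal_le_one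
  have h2 : P.real A * P.real B ≤ 1 := mul_le_one₀ measureReal_le_one measureReal_nonneg
    measureReal_le_one
  have h3 : 0 ≤ P.real (A ∩ B) := measureReal_nonneg
  have h4 : 0 ≤ P.real A * P.real B := mul_nonneg measureReal_nonneg measureReal_nonneg
  exact abs_sub_le_iff.2 ⟨by linarith, by linarith⟩

theorem sum_le_of_mem_thetaDelta {β δ : ℝ} {b : Fin p → ℝ} (ha : a ∈ ThetaDelta p β b δ) :
    (∀ j, 0 ≤ a j) ∧ ∑ j, a j ≤ l1Norm b + δ := by
  refine ⟨ha.2.1, ?_⟩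
  have h1 : l1Norm (fun i => a i - b i) ≤ δ := ha.1
  unfold l1Norm at *
  have h2 : ∑ j, a j ≤ ∑ j, (|b j| + |a j - b j|) := by
    refine Finset.sum_le_sum fun j _ => ?_
    linarith [le_abs_self (a j - b j), le_abs_self (b j)]
  rw [Finset.sum_add_distrib] at h2
  linarith

end

end ARCH

theorem mainTheorem1 {Ω : Type*} [MeasurableSpace Ω] (P : Measure Ω) [IsProbabilityMeasure P]
    (p : ℕ) (g : ℝ → ℝ) (ε : ℤ → Ω → ℝ)
    (hε : ARCH.IIDWithDensity P ε g)
    (hmean : ∫ ω, ε 1 ω ∂P = 0)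
    (hsq : Integrable (fun ω => ε 1 ω ^ 2) P)
    (hg : ARCH.RegularDensity g)
    (β : ℝ) (hβ : 0 < β) (hβε : β ≤ ∫ ω, ε 1 ω ^ 2 ∂P)
    (b : Fin p → ℝ) (hb : b ∈ ARCH.Theta p β)
    (δ : ℝ) (hδ : 0 < δ)
    (hstat : (∫ ω, ε 1 ω ^ 2 ∂P) * (ARCH.l1Norm b + δ) < 1) :
    ∃ C γ : ℝ, 0 < γ ∧
      ∀ a ∈ ARCH.ThetaDelta p β b δ, ∀ y : ℤ → Ω → ℝ, ARCH.IsStationarySolution P ε a y →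
        ∀ t : ℤ,
          ARCH.strongMixingCoeff P (ARCH.sigmaLag p y (t - 1)) (ARCH.sigmaPast y)
            ≤ C * Real.exp (-γ * t) := by
  set m := ∫ ω, ε 1 ω ^ 2 ∂P with hm
  set S := ARCH.l1Norm b + δ with hS
  have hm0 : 0 < m := hβ.trans_le hβε
  have hS0 : 0 < S := add_pos_of_nonneg_of_pos (Finset.sum_nonneg fun _ _ => abs_nonneg _) hδ
  have hρ0 : 0 < m * S := mul_pos hm0 hS0
  -- the rate is a `(p + 1)`-st root, which covers `p = 0`
  obtain ⟨θ, hθ, hθ1, hθp⟩ : ∃ θ : ℝ, 0 < θ ∧ θ < 1 ∧ m * S ≤ θ ^ p := by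
    refine ⟨(m * S) ^ ((p + 1 : ℝ)⁻¹), Real.rpow_pos_of_pos hρ0 _,
      Real.rpow_lt_one hρ0.le hstat (by positivity), ?_⟩
    rw [← Real.rpow_natCast, ← Real.rpow_mul hρ0.le]
    refine (Real.rpow_one _).symm.le.trans (Real.rpow_le_rpow_of_exponent_ge hρ0 hstat.le ?_)
    rw [inv_mul_le_iff₀ (by positivity)]
    linarith
  set κ := m / (1 - m * S) with hκ
  have hκ0 : 0 ≤ κ := div_nonneg hm0.le (sub_nonneg.2 hstat.le)
  have hκe : (1 + S * κ) * m = κ := by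
    have : 1 - m * S ≠ 0 := (sub_pos.2 hstat).ne'
    have h1 : κ * (1 - m * S) = m := div_mul_cancel₀ m this
    linear_combination -h1
  set E := 2 * (p * (ARCH.scaleConst g * S) * (p * κ) * (p * θ⁻¹ ^ p)) with hE
  have hE0 : 0 ≤ E := by
    have := ARCH.scaleConst_nonneg g
    positivity
  have hexp : ∀ t : ℤ, Real.exp (-(-Real.log θ) * t) = θ ^ t := by
    intro t
    rw [neg_neg, ← Real.rpow_def_of_pos hθ, Real.rpow_intCast]
  refine ⟨(E + 1) * θ⁻¹ ^ (p + 1), -Real.log θ, neg_pos.2 (Real.log_neg hθ hθ1), ?_⟩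
  intro a ha y hy t
  obtain ⟨ha0, haS⟩ := ARCH.sum_le_of_mem_thetaDelta ha
  have hC : (E + 1) * θ⁻¹ ^ (p + 1) * Real.exp (-(-Real.log θ) * t) =
      (E + 1) * θ ^ (t - (p + 1 : ℕ)) := by
    rw [hexp, mul_assoc, zpow_sub₀ hθ.ne', zpow_natCast, inv_pow, div_eq_inv_mul]
  rw [hC]
  have hpos : 0 < θ ^ (t - (p + 1 : ℕ)) := zpow_pos hθ _
  refine Real.sSup_le ?_ (by positivity)
  rintro r ⟨A, B, hA, hB, rfl⟩
  by_cases ht : (p + 1 : ℕ) ≤ t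
  · obtain ⟨n, hn⟩ := Int.eq_ofNat_of_zero_le (sub_nonneg.2 ht)
    have ht' : t - 1 = n + p := by push_cast at hn; omega
    rw [ht'] at hA
    rw [hn, zpow_natCast]
    refine (hy.abs_measureReal_sub_le hε hg hsq hθ hθ1 ha0 ?_ haS hκ0 ?_ n hA hB).trans ?_
    · refine le_trans ?_ hθp
      rw [mul_comm m]
      exact mul_le_mul_of_nonneg_right haS hm0.le
    · refine le_trans ?_ hκe.le
      gcongr
    · rw [← mul_assoc, ← hE]
      exact mul_le_mul_of_nonneg_right (by linarith) (pow_nonneg hθ.le n)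
  · refine (ARCH.abs_measureReal_inter_sub_le_one A B).trans ?_
    have h1 : 1 ≤ θ ^ (t - (p + 1 : ℕ)) := one_le_zpow_of_nonpos₀ hθ hθ1.le (by omega)
    nlinarith
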